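/- For a family $\mathcal F$ of graphs, the $\mathcal F$-saturation game on $n$ vertices is played by two players, Max and Mini, starting from the empty graph on $n$ vertices. Beginning with Max, the players alternately add a new edge to the graph, subject to the condition that the resulting graph contains no subgraph isomorphic to a member of $\mathcal F$; the game ends when no such edge exists. Max wants the number of edges of the final graph to be as large as possible, Mini wants it to be as small as possible, and $\mathrm{sat}_g(n,\mathcal F)$ denotes the number of edges of the final graph when both players play optimally. Let $\mathcal C^o_{\ge m}$ be the family of all odd cycles of length at least $m$. Then for all integers $k\ge 2$ and $n\ge 1$, $$\mathrm{sat}_g(n,\mathcal C^o_{\ge 2k+1})\le (3k+1)(n-1).$$ -/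

import Mathlib

/-- A family of finite graphs, each member taken (up to isomorphism) on a vertex set `Fin m`. -/
abbrev GraphFamily : Type := Set (Σ m : ℕ, SimpleGraph (Fin m))

/-- The family of all odd cycles `C_ℓ` of length `ℓ ≥ k` (a cycle has length at least `3`). -/
def oddCyclesGE (k : ℕ) : GraphFamily :=
  {F | ∃ ℓ : ℕ, 3 ≤ ℓ ∧ k ≤ ℓ ∧ Odd ℓ ∧ F = ⟨ℓ, SimpleGraph.cycleGraph ℓ⟩}

/-- `G` has no (not necessarily induced) subgraph isomorphic to a member of `𝓕`. -/
def FamilyFree {V : Type*} (𝓕 : GraphFamily) (G : SimpleGraph V) : Prop :=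
  ∀ F ∈ 𝓕, ¬ SimpleGraph.IsContained F.2 G

/-- `H` arises from `G` by a legal move of the `𝓕`-saturation game: a single new edge is added,
and no member of `𝓕` is created. -/
def LegalMove {V : Type*} (𝓕 : GraphFamily) (G H : SimpleGraph V) : Prop :=
  ∃ u v : V, u ≠ v ∧ ¬ G.Adj u v ∧ H = G ⊔ SimpleGraph.edge u v ∧ FamilyFree 𝓕 H

theorem LegalMove.lt {V : Type*} {𝓕 : GraphFamily} {G H : SimpleGraph V}
    (h : LegalMove 𝓕 G H) : G < H := by
  obtain ⟨u, v, huv, hn, rfl, -⟩ := h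
  refine lt_of_le_of_ne le_sup_left fun he => hn ?_
  rw [he]
  simp [SimpleGraph.edge_adj, huv]

theorem LegalMove.ncard_compl_lt {V : Type*} [Finite V] {𝓕 : GraphFamily} {G H : SimpleGraph V}
    (h : LegalMove 𝓕 G H) : (Hᶜ).edgeSet.ncard < (Gᶜ).edgeSet.ncard :=
  Set.ncard_lt_ncard (SimpleGraph.edgeSet_ssubset_edgeSet.2 (compl_lt_compl_iff_lt.2 h.lt))
    (Set.toFinite _)

/-- The two players: `max` wants many edges in the final graph, `mini` wants few. -/
inductive Player : Type
  | max
  | mini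

open Classical in
/-- The number of edges of the final graph when the `𝓕`-saturation game is continued from
position `G` with player `p` to move and both players play optimally. The game is over when
there is no legal move; otherwise the player to move must add an edge. -/
noncomputable def gameScore {V : Type*} [Finite V] (𝓕 : GraphFamily) (p : Player)
    (G : SimpleGraph V) : ℕ :=
  if ∃ H, LegalMove 𝓕 G H then
    match p with
    | Player.max => ⨆ H : {H : SimpleGraph V // LegalMove 𝓕 G H}, gameScore 𝓕 Player.mini H.1
    | Player.mini => ⨅ H : {H : SimpleGraph V // LegalMove 𝓕 G H}, gameScore 𝓕 Player.max H.1
  else G.edgeSet.ncard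
termination_by (Gᶜ).edgeSet.ncard
decreasing_by
  all_goals exact H.2.ncard_compl_lt

/-- The game saturation number `sat_g(n, 𝓕)`: the game starts from the empty graph on `n`
vertices, and Max moves first. -/
noncomputable def gameSaturationNumber (n : ℕ) (𝓕 : GraphFamily) : ℕ :=
  gameScore 𝓕 Player.max (⊥ : SimpleGraph (Fin n))

/-! The even part of a graph consists of its edges on no odd cycle. Mini keeps every trail of the
even part at three edges or fewer after each of her moves. Max's edge adds at most itself to the
even part (`evenPart_sup_edge_le`). If this creates a longer trail, Mini closes a triangle over the
new edge and an adjacent even edge, which removes both from the even part. Otherwise she closes a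
triangle over any two adjacent even edges or, if the even part is a matching, plays any legal edge
(`exists_answer`). These triangles create no long odd cycle (`OddCyclesLT.sup_edge`), because a
cycle with one edge in the even part lies in it entirely (`IsCycle.onOddCycle_of_even`).

A graph with this property is sparse. Minimum degree `3k - 1` within a vertex set forces an odd
cycle of length at least `2k + 1` or an even one of length at least `4k` (`exists_long_cycle`). The
former is forbidden. The latter either lies in the even part and is too long a trail, or yields an
odd cycle longer than half of it. So the graph is `(3k - 2)`-degenerate and has at most `(3k - 2)(n
- 1)` edges, which is within the asserted bound. -/

namespace SimpleGraph

variable {V : Type*} {G H : SimpleGraph V}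

/-- The edge `e` lies on an odd cycle of `G`. -/
def OnOddCycle (G : SimpleGraph V) (e : Sym2 V) : Prop :=
  ∃ (u : V) (c : G.Walk u u), c.IsCycle ∧ Odd c.length ∧ e ∈ c.edges

/-! ### Parity along paths, and ears of even cycles. -/

namespace Walk

theorem IsCycle.exists_isPath_of_mem_edges {r a b : V} {c : G.Walk r r} (hc : c.IsCycle)
    (h : s(a, b) ∈ c.edges) :
    ∃ p : G.Walk b a, p.IsPath ∧ s(a, b) ∉ p.edges ∧ p.length + 1 = c.length ∧
      ∀ e, e ∈ c.edges ↔ e = s(a, b) ∨ e ∈ p.edges := by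
  classical
  have main : ∀ d : G.Walk a a, d.IsCycle → d.snd = b →
      ∃ p : G.Walk b a, p.IsPath ∧ s(a, b) ∉ p.edges ∧ p.length + 1 = d.length ∧
        ∀ e, e ∈ d.edges ↔ e = s(a, b) ∨ e ∈ p.edges := by
    intro d hd hs
    cases d with
    | nil => exact absurd hd (by simp)
    | cons h q =>
      simp only [snd_cons] at hs
      subst hs
      obtain ⟨hq, he⟩ := (cons_isCycle_iff _ _).1 hd
      exact ⟨q, hq, he, by simp, by simp⟩
  have ha := c.fst_mem_support_of_mem_edges h
  have hrot := hc.rotate ha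
  have hmem : ∀ e, e ∈ (c.rotate a ha).edges ↔ e ∈ c.edges :=
    fun e => (c.rotate_edges a ha).perm.mem_iff
  have hlen := c.length_rotate a ha
  -- In the cycle rotated to start at `a`, the edge `ab` is the first or the last one.
  have hb : (c.rotate a ha).snd = b ∨ (c.rotate a ha).reverse.snd = b := by
    have h' := (hmem _).2 h
    revert hrot h'
    generalize c.rotate a ha = d
    intro hd h'
    cases d with
    | nil => simp at h'
    | cons hadj q =>
      obtain ⟨hq, he⟩ := (cons_isCycle_iff _ _).1 hd
      rw [edges_cons, List.mem_cons] at h'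
      rcases h' with h' | h'
      · left
        rcases Sym2.eq_iff.1 h' with ⟨-, h'⟩ | ⟨h', -⟩
        · simpa using h'.symm
        · exact absurd h' hadj.ne
      · right
        have hqn : ¬ q.Nil := not_nil_of_isCycle_cons hd
        rw [snd_reverse, penultimate_cons_of_not_nil _ _ hqn]
        exact (hq.eq_penultimate_of_mem_edges h').symm
  rcases hb with hb | hb
  · obtain ⟨p, h1, h2, h3, h4⟩ := main _ hrot hb
    exact ⟨p, h1, h2, by rw [h3, hlen], fun e => by rw [← hmem, h4]⟩
  · obtain ⟨p, h1, h2, h3, h4⟩ := main _ hrot.reverse hb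
    exact ⟨p, h1, h2, by rw [h3, length_reverse, hlen], fun e => by
      rw [← hmem, ← h4, edges_reverse, List.mem_reverse]⟩

theorem exists_append_first_mem (S : Set V) {a b : V} (p : G.Walk a b) (hb : b ∈ S) :
    ∃ x ∈ S, ∃ (q : G.Walk a x) (r : G.Walk x b), p = q.append r ∧
      ∀ z ∈ q.support, z ∈ S → z = x := by
  induction p with
  | nil => exact ⟨_, hb, nil, nil, rfl, by simp⟩
  | @cons u v w h p ih =>
    by_cases hu : u ∈ S
    · exact ⟨u, hu, nil, cons h p, rfl, by simp⟩
    · obtain ⟨x, hx, q, r, rfl, hq⟩ := ih hb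
      refine ⟨x, hx, cons h q, r, rfl, ?_⟩
      intro z hz hzS
      rw [support_cons, List.mem_cons] at hz
      rcases hz with rfl | hz
      · exact absurd hzS hu
      · exact hq z hz hzS

/-- A path between vertices of `S` whose length has the wrong parity contains a subpath of wrong
parity that meets `S` only in its ends. -/
theorem IsPath.exists_ear (S : Set V) (col : V → ZMod 2) {a b : V} (p : G.Walk a b)
    (hp : p.IsPath) (ha : a ∈ S) (hb : b ∈ S) (hc : (p.length : ZMod 2) ≠ col a + col b) :
    ∃ x ∈ S, ∃ y ∈ S, ∃ q : G.Walk x y, q.IsPath ∧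
      (∀ z ∈ q.support, z ∈ S → z = x ∨ z = y) ∧ (q.length : ZMod 2) ≠ col x + col y := by
  induction hn : p.length using Nat.strong_induction_on generalizing a with
  | _ n ih =>
  cases p with
  | nil => exact absurd (by simp [CharTwo.add_self_eq_zero]) hc
  | @cons _ v _ h p =>
    obtain ⟨x, hx, q, r, rfl, hq⟩ := exists_append_first_mem S p hb
    have hp' : ((cons h q).append r).IsPath := hp
    -- The path is cut at its first return to `S`. If that piece has the right parity, the remainder
    -- has the wrong one.
    by_cases hpar : ((cons h q).length : ZMod 2) = col a + col x
    · refine ih r.length ?_ r hp'.of_append_right hx ?_ rfl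
      · rw [← hn]; simp
      · intro hr
        apply hc
        have : ((cons h (q.append r)).length : ZMod 2) = (cons h q).length + r.length := by
          simp; ring
        rw [this, hpar, hr]
        have := CharTwo.add_self_eq_zero (col x)
        linear_combination this
    · refine ⟨a, ha, x, hx, cons h q, hp'.of_append_left, ?_, hpar⟩
      intro z hz hzS
      rw [support_cons, List.mem_cons] at hz
      exact hz.imp id fun hz => hq z hz hzS

theorem length_eq_add_of_alternating {E : Set (Sym2 V)} {col : V → ZMod 2}
    (hcol : ∀ x y, s(x, y) ∈ E → col x + col y = 1) {a b : V} (p : G.Walk a b)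
    (hp : ∀ e ∈ p.edges, e ∈ E) : (p.length : ZMod 2) = col a + col b := by
  induction p with
  | nil => simp [CharTwo.add_self_eq_zero]
  | @cons u v w h p ih =>
    have h1 := hcol _ _ (hp s(u, v) (by simp))
    have h2 := ih fun e he => hp e (by simp [he])
    have := CharTwo.add_self_eq_zero (col v)
    push_cast [length_cons]
    linear_combination h2 - h1 + this

theorem IsPath.exists_alternating {a b : V} {p : G.Walk a b} (hp : p.IsPath) :
    ∃ col : V → ZMod 2, ∀ x y, s(x, y) ∈ p.edges → col x + col y = 1 := by
  classical
  induction p with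
  | nil => exact ⟨0, by simp⟩
  | @cons u v w h p ih =>
    rw [cons_isPath_iff] at hp
    obtain ⟨col, hcol⟩ := ih hp.1
    refine ⟨Function.update col u (col v + 1), fun x y hxy => ?_⟩
    have := CharTwo.add_self_eq_zero (col v)
    have hvu : v ≠ u := h.ne'
    rw [edges_cons, List.mem_cons] at hxy
    rcases hxy with hxy | hxy
    · rw [Sym2.eq_iff] at hxy
      rcases hxy with ⟨rfl, rfl⟩ | ⟨rfl, rfl⟩
      · simp [hvu]; linear_combination this
      · simp [hvu]; linear_combination this
    · have hx : x ≠ u := fun e => hp.2 (e ▸ p.fst_mem_support_of_mem_edges hxy)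
      have hy : y ≠ u := fun e => hp.2 (e ▸ p.snd_mem_support_of_mem_edges hxy)
      simpa [hx, hy] using hcol x y hxy

/-- Without its first edge the cycle is a path of odd length, so its ends get different colours and
the removed edge alternates too. -/
theorem IsCycle.exists_alternating {r : V} {c : G.Walk r r} (hc : c.IsCycle)
    (heven : Even c.length) :
    ∃ col : V → ZMod 2, ∀ x y, s(x, y) ∈ c.edges → col x + col y = 1 := by
  cases c with
  | nil => exact absurd hc (by simp)
  | @cons _ v _ h p =>
    obtain ⟨hp, he⟩ := (cons_isCycle_iff _ _).1 hc
    obtain ⟨col, hcol⟩ := hp.exists_alternating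
    refine ⟨col, fun x y hxy => ?_⟩
    rw [edges_cons, List.mem_cons] at hxy
    rcases hxy with hxy | hxy
    · have h1 := length_eq_add_of_alternating (E := {e | e ∈ p.edges}) hcol p (fun e he => he)
      have h2 : (p.length : ZMod 2) = 1 := by
        rw [ZMod.natCast_eq_one_iff_odd]
        rw [length_cons] at heven
        grind
      rw [h2] at h1
      rw [Sym2.eq_iff] at hxy
      rcases hxy with ⟨rfl, rfl⟩ | ⟨rfl, rfl⟩
      · rw [add_comm]; exact h1.symm
      · exact h1.symm
    · exact hcol x y hxy

/-- If an edge of an even cycle lies on an odd cycle, then so do all its edges, and there is an odd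
cycle longer than half of the even one. -/
theorem IsCycle.onOddCycle_of_even {r : V} {c : G.Walk r r} (hc : c.IsCycle)
    (heven : Even c.length) {f : Sym2 V} (hf : f ∈ c.edges) (hodd : OnOddCycle G f) :
    (∀ e ∈ c.edges, OnOddCycle G e) ∧
      ∃ (z : V) (d : G.Walk z z), d.IsCycle ∧ Odd d.length ∧ c.length < 2 * d.length := by
  classical
  obtain ⟨col, hcol⟩ := hc.exists_alternating heven
  obtain ⟨t, o, ho, holen, hfo⟩ := hodd
  induction f with | _ a b =>
  obtain ⟨p, hp, -, hplen, -⟩ := ho.exists_isPath_of_mem_edges hfo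
  -- The rest of the odd cycle is an even path between the differently coloured ends of `f`, hence
  -- contains an ear of wrong parity.
  have hpar : (p.length : ZMod 2) ≠ col b + col a := by
    have : (p.length : ZMod 2) = 0 := by
      rw [ZMod.natCast_eq_zero_iff_even]; grind
    rw [this, add_comm, hcol _ _ hf]
    decide
  obtain ⟨x, hx, y, hy, q, hq, hqS, hqpar⟩ := hp.exists_ear {z | z ∈ c.support} col p
    (c.snd_mem_support_of_mem_edges hf) (c.fst_mem_support_of_mem_edges hf) hpar
  have hxy : x ≠ y := by
    rintro rfl
    rw [Walk.length_eq_zero_iff.2 (isPath_iff_nil.1 hq)] at hqpar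
    exact hqpar (by simp [CharTwo.add_self_eq_zero])
  have hd := hc.rotate hx
  have hde : ∀ e, e ∈ (c.rotate x hx).edges ↔ e ∈ c.edges :=
    fun e => (c.rotate_edges x hx).perm.mem_iff
  have hds : ∀ z, z ∈ (c.rotate x hx).support ↔ z ∈ c.support :=
    fun z => mem_support_rotate_iff c x hx
  have hdl := c.length_rotate x hx
  revert hd hde hds hdl
  generalize c.rotate x hx = d
  intro hd hde hds hdl
  have hyd := (hds y).2 hy
  have hspec := d.take_spec hyd
  have h1 : (d.takeUntil y hyd).IsPath := hd.isPath_takeUntil hyd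
  have h2 : (d.dropUntil y hyd).IsPath := by
    rw [← hspec] at hd
    exact hd.isPath_of_append_right (not_nil_of_ne hxy)
  have hlen : (d.takeUntil y hyd).length + (d.dropUntil y hyd).length = c.length := by
    rw [← hdl, ← length_append, hspec]
  have hedge : ∀ e ∈ c.edges, e ∈ (d.takeUntil y hyd).edges ∨ e ∈ (d.dropUntil y hyd).edges := by
    intro e he
    rw [← hde, ← hspec, edges_append, List.mem_append] at he
    exact he
  -- An arc of `c` has the parity given by the colours and the ear has the other, so together they
  -- form an odd cycle. The two arcs cover `c`, and the longer one with the ear exceeds half of its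
  -- length.
  have key : ∀ {x y : V} (q : G.Walk x y) (s : G.Walk y x), q.IsPath → s.IsPath → x ≠ y →
      (∀ z ∈ q.support, z ∈ c.support → z = x ∨ z = y) → (q.length : ZMod 2) ≠ col x + col y →
      (∀ e ∈ s.edges, e ∈ c.edges) → (∀ z ∈ s.support, z ∈ c.support) →
      (q.append s).IsCycle ∧ Odd (q.append s).length := by
    intro x y q s hq hs hxy hqS hqpar hse hss
    have hspar := length_eq_add_of_alternating (E := {e | e ∈ c.edges}) hcol s hse
    have hodd : Odd (q.append s).length := by
      rw [← Nat.not_even_iff_odd, ← ZMod.natCast_eq_zero_iff_even, length_append]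
      push_cast
      intro h
      apply hqpar
      have h3 := CharTwo.add_self_eq_zero (s.length : ZMod 2)
      linear_combination h + hspar - h3
    refine ⟨hq.isCycle_append hs ?_ ?_, hodd⟩
    · intro z hz1 hz2
      have hzs : z ∈ s.support := List.mem_of_mem_tail hz2
      rcases hqS z (List.mem_of_mem_tail hz1) (hss z hzs) with rfl | rfl
      · have := hq.support_nodup
        rw [← cons_tail_support, List.nodup_cons] at this
        exact this.1 hz1
      · have := hs.support_nodup
        rw [← cons_tail_support, List.nodup_cons] at this
        exact this.1 hz2
    · have hq1 : q.length ≠ 0 := fun h => hxy (eq_of_length_eq_zero h)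
      have hs1 : s.length ≠ 0 := fun h => hxy (eq_of_length_eq_zero h).symm
      rw [length_append] at hodd
      grind
  have hc1 := key q.reverse (d.takeUntil y hyd) hq.reverse h1 hxy.symm
    (fun z hz hzc => (hqS z (by simpa using hz) hzc).symm)
    (by rwa [length_reverse, add_comm])
    (fun e he => (hde e).1 (d.edges_takeUntil_subset_edges hyd he))
    (fun z hz => (hds z).1 (d.support_takeUntil_subset_support hyd hz))
  have hc2 := key q (d.dropUntil y hyd) hq h2 hxy hqS hqpar
    (fun e he => (hde e).1 (d.edges_dropUntil_subset_edges hyd he))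
    (fun z hz => (hds z).1 (d.support_dropUntil_subset_support hyd hz))
  have hq1 : q.length ≠ 0 := fun h => hxy (eq_of_length_eq_zero h)
  refine ⟨fun e he => ?_, ?_⟩
  · rcases hedge e he with he | he
    · exact ⟨_, _, hc1.1, hc1.2, by rw [edges_append]; exact List.mem_append_right _ he⟩
    · exact ⟨_, _, hc2.1, hc2.2, by rw [edges_append]; exact List.mem_append_right _ he⟩
  · rcases le_total (d.takeUntil y hyd).length (d.dropUntil y hyd).length with h | h
    · exact ⟨_, _, hc2.1, hc2.2, by rw [length_append]; omega⟩
    · exact ⟨_, _, hc1.1, hc1.2, by rw [length_append, length_reverse]; omega⟩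

end Walk

/-! ### The even part, and the effect of closing a triangle. -/

theorem OnOddCycle.mono (h : G ≤ H) {e : Sym2 V} (he : OnOddCycle G e) : OnOddCycle H e := by
  obtain ⟨u, c, hc, ho, hce⟩ := he
  exact ⟨u, c.mapLe h, hc.mapLe h, by simpa using ho, by simpa using hce⟩

/-- The subgraph of the edges that lie on no odd cycle. -/
def evenPart (G : SimpleGraph V) : SimpleGraph V where
  Adj a b := G.Adj a b ∧ ¬ G.OnOddCycle s(a, b)
  symm := ⟨fun a b h => ⟨h.1.symm, by rw [Sym2.eq_swap]; exact h.2⟩⟩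
  loopless := ⟨fun a h => G.irrefl h.1⟩

theorem evenPart_le : G.evenPart ≤ G := fun _ _ h => h.1

theorem mem_edgeSet_evenPart {e : Sym2 V} :
    e ∈ G.evenPart.edgeSet ↔ e ∈ G.edgeSet ∧ ¬ G.OnOddCycle e := by
  induction e with | _ a b => rfl

/-- All cycles of odd length have length less than `m`. -/
def OddCyclesLT (G : SimpleGraph V) (m : ℕ) : Prop :=
  ∀ (u : V) (c : G.Walk u u), c.IsCycle → Odd c.length → c.length < m

/-- No trail has more than three edges. -/
def TrailsLEThree (G : SimpleGraph V) : Prop :=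
  ∀ (u v : V) (p : G.Walk u v), p.IsTrail → p.length ≤ 3

theorem TrailsLEThree.anti (h : G ≤ H) (hH : TrailsLEThree H) : TrailsLEThree G := by
  intro u v p hp
  have := hH u v (p.mapLe h) (hp.mapLe h)
  simpa using this

/-- No vertex has two neighbours. -/
def IsMatchingGraph (G : SimpleGraph V) : Prop :=
  ∀ a b c, G.Adj a b → G.Adj b c → a = c

namespace Walk

theorem IsTrail.transfer {u v : V} {p : G.Walk u v} (hp : p.IsTrail)
    (h : ∀ e ∈ p.edges, e ∈ H.edgeSet) : (p.transfer H h).IsTrail := by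
  rw [isTrail_def, edges_transfer]
  exact hp.edges_nodup

theorem IsCycle.forall_mem_evenPart {r : V} {c : G.Walk r r} (hc : c.IsCycle) {f : Sym2 V}
    (hf : f ∈ c.edges) (hfe : f ∈ G.evenPart.edgeSet) :
    Even c.length ∧ ∀ e ∈ c.edges, e ∈ G.evenPart.edgeSet := by
  have hne := (mem_edgeSet_evenPart.1 hfe).2
  have heven : Even c.length := by
    rw [← Nat.not_odd_iff_even]
    exact fun h => hne ⟨r, c, hc, h, hf⟩
  refine ⟨heven, fun e he => mem_edgeSet_evenPart.2 ⟨c.edges_subset_edgeSet he, fun h => ?_⟩⟩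
  exact hne ((hc.onOddCycle_of_even heven he h).1 f hf)

/-- Cycles of the even part have even length, which excludes triangles. Hence each is a trail longer
than three. -/
theorem IsCycle.four_le_length_of_evenPart {r : V} {c : G.evenPart.Walk r r} (hc : c.IsCycle) :
    4 ≤ c.length := by
  have h3 := hc.three_le_length
  have hc' := hc.mapLe G.evenPart_le
  obtain ⟨e, he⟩ : ∃ e, e ∈ c.edges :=
    List.exists_mem_of_length_pos (by rw [length_edges]; omega)
  have := (hc'.forall_mem_evenPart (f := e) (by simpa using he) (c.edges_subset_edgeSet he)).1
  rw [length_mapLe] at this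
  grind

end Walk

theorem TrailsLEThree.isAcyclic_evenPart (h : TrailsLEThree G.evenPart) : G.evenPart.IsAcyclic := by
  intro r c hc
  have := h r r c hc.isTrail
  have := hc.four_le_length_of_evenPart
  omega

/-- Old odd cycles survive the insertion, so only the new edge can join the even part. -/
theorem evenPart_sup_edge_le (u v : V) : (G ⊔ edge u v).evenPart ≤ G.evenPart ⊔ edge u v := by
  intro a b h
  rcases h.1 with h1 | h1
  · exact Or.inl ⟨h1, fun h2 => h.2 (h2.mono le_sup_left)⟩
  · exact Or.inr h1

theorem evenPart_anti_of_le (h : G ≤ H) {a b : V} (hab : H.evenPart.Adj a b) (hG : G.Adj a b) :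
    G.evenPart.Adj a b := ⟨hG, fun h2 => hab.2 (h2.mono h)⟩

theorem onOddCycle_of_triangle {a b c : V} (hab : G.Adj a b) (hbc : G.Adj b c) (hca : G.Adj c a) :
    OnOddCycle G s(a, b) ∧ OnOddCycle G s(b, c) ∧ OnOddCycle G s(c, a) := by
  have hcyc : (Walk.cons hab (Walk.cons hbc (Walk.cons hca Walk.nil))).IsCycle := by
    rw [Walk.cons_isCycle_iff]
    simp [hab.ne, hbc.ne, hca.ne, hab.ne', hca.ne']
  refine ⟨⟨a, _, hcyc, ?_, ?_⟩, ⟨a, _, hcyc, ?_, ?_⟩, ⟨a, _, hcyc, ?_, ?_⟩⟩ <;>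
    first
    | exact ⟨1, by simp⟩
    | simp

theorem not_adj_of_evenPart {a b c : V} (hab : G.evenPart.Adj a b) (hbc : G.evenPart.Adj b c) :
    ¬ G.Adj a c := fun h => hab.2 (onOddCycle_of_triangle hab.1 hbc.1 h.symm).1

/-- Closing a triangle over two edges that lie on no odd cycle creates no long odd cycle, provided
that the short cycles through these edges are under control. -/
theorem OddCyclesLT.sup_edge {m : ℕ} (hm : 4 ≤ m) (hG : OddCyclesLT G m) {a b c : V}
    (hab : G.evenPart.Adj a b) (hbc : G.evenPart.Adj b c) (hac : a ≠ c)
    (h6 : ∀ (r : V) (d : G.evenPart.Walk r r), d.IsCycle → s(a, b) ∈ d.edges → d.length < 6)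
    (hc : ∀ (r : V) (d : G.evenPart.Walk r r), d.IsCycle → s(a, b) ∈ d.edges → c ∈ d.support)
    (ha : ∀ (r : V) (d : G.evenPart.Walk r r), d.IsCycle → s(b, c) ∈ d.edges → a ∈ d.support) :
    OddCyclesLT (G ⊔ edge a c) m := by
  classical
  intro r d hd hodd
  by_contra! hlen
  have hsub : ∀ e ∈ (G ⊔ edge a c).edgeSet, e ≠ s(a, c) → e ∈ G.edgeSet := by
    intro e he hne
    induction e with | _ x y =>
    rcases he with he | he
    · exact he
    · rw [edge_adj] at he
      exact absurd (Sym2.eq_iff.2 he.1.symm) (by grind)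
  by_cases hmem : s(a, c) ∈ d.edges
  swap
  · have ht : ∀ e ∈ d.edges, e ∈ G.edgeSet := fun e he =>
      hsub e (d.edges_subset_edgeSet he) (fun h => hmem (h ▸ he))
    have := hG r (d.transfer G ht) (hd.transfer ht) (by simpa using hodd)
    rw [Walk.length_transfer] at this
    omega
  obtain ⟨p, hp, hpe, hpl, -⟩ := hd.exists_isPath_of_mem_edges hmem
  have ht : ∀ e ∈ p.edges, e ∈ G.edgeSet := fun e he =>
    hsub e (p.edges_subset_edgeSet he) (fun h => hpe (h ▸ he))
  obtain ⟨q, hq, hql⟩ : ∃ q : G.Walk a c, q.IsPath ∧ q.length + 1 = d.length :=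
    ⟨(p.transfer G ht).reverse, (hp.transfer ht).reverse, by simpa using hpl⟩
  have hcycle : ∀ (r : V) (d : G.Walk r r) (f : Sym2 V), d.IsCycle → f ∈ d.edges →
      f ∈ G.evenPart.edgeSet → ∃ d' : G.evenPart.Walk r r, d'.IsCycle ∧ d'.edges = d.edges ∧
        d'.support = d.support ∧ d'.length = d.length := by
    intro r d f hd hf hfe
    have := (hd.forall_mem_evenPart hf hfe).2
    exact ⟨d.transfer _ this, hd.transfer this, by simp, by simp, by simp⟩
  have hba : b ≠ a := hab.ne'
  have hbc' : b ≠ c := hbc.ne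
  -- If `q` visits `b`, its piece from `a` to `b` is the edge `ab`; otherwise the two would form a
  -- cycle of the even part that misses `c`. The same holds from `b` to `c`, so `d` is a triangle,
  -- shorter than `m`.
  by_cases hb : b ∈ q.support
  · have hspec := q.take_spec hb
    have hc1 : c ∉ (q.takeUntil b hb).support := by
      intro h
      have hq' := hq
      rw [← hspec] at hq'
      exact hbc' (hq'.ne_of_mem_support_of_append hbc'.symm h (Walk.end_mem_support _) rfl).elim
    have ha1 : a ∉ (q.dropUntil b hb).support := by
      intro h
      have hq' := hq
      rw [← hspec] at hq'
      exact (hq'.ne_of_mem_support_of_append hba.symm (Walk.start_mem_support _) h rfl).elim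
    have h1 : (q.takeUntil b hb).length = 1 := by
      by_cases hmem : s(a, b) ∈ (q.takeUntil b hb).edges
      · exact (hq.takeUntil hb).length_eq_one_of_mem_edges hmem
      · have hcyc : (Walk.cons hab.1.symm (q.takeUntil b hb)).IsCycle :=
          (Walk.cons_isCycle_iff _ _).2 ⟨hq.takeUntil hb, by rwa [Sym2.eq_swap]⟩
        obtain ⟨d', hd', he', hs', -⟩ := hcycle _ _ s(a, b) hcyc (by simp [Sym2.eq_swap]) hab
        have := hc _ d' hd' (by rw [he']; simp [Sym2.eq_swap])
        rw [hs', Walk.support_cons, List.mem_cons] at this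
        exact (this.elim (fun h => hbc' h.symm) hc1).elim
    have h2 : (q.dropUntil b hb).length = 1 := by
      by_cases hmem : s(b, c) ∈ (q.dropUntil b hb).edges
      · exact (hq.dropUntil hb).length_eq_one_of_mem_edges hmem
      · have hcyc : (Walk.cons hbc.1.symm (q.dropUntil b hb)).IsCycle :=
          (Walk.cons_isCycle_iff _ _).2 ⟨hq.dropUntil hb, by rwa [Sym2.eq_swap]⟩
        obtain ⟨d', hd', he', hs', -⟩ := hcycle _ _ s(b, c) hcyc (by simp [Sym2.eq_swap]) hbc
        have := ha _ d' hd' (by rw [he']; simp [Sym2.eq_swap])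
        rw [hs', Walk.support_cons, List.mem_cons] at this
        exact (this.elim hac ha1).elim
    have := congrArg Walk.length hspec
    rw [Walk.length_append] at this
    omega
  -- If `q` misses `b`, replacing `ac` by `a, b, c` gives a cycle of the even part. As `d` is odd of
  -- length at least 5, this cycle has at least 6 edges, against `h6`.
  · have hcyc : (Walk.cons hbc.1.symm (Walk.cons hab.1.symm q)).IsCycle := by
      rw [Walk.cons_isCycle_iff, Walk.cons_isPath_iff]
      refine ⟨⟨hq, hb⟩, ?_⟩
      rw [Walk.edges_cons, List.mem_cons, not_or]
      refine ⟨?_, fun h => hb (q.snd_mem_support_of_mem_edges h)⟩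
      rw [Sym2.eq_iff]
      rintro (⟨h, -⟩ | ⟨h, -⟩)
      · exact hbc' h.symm
      · exact hac h.symm
    obtain ⟨d', hd', he', -, hl'⟩ := hcycle _ _ s(a, b) hcyc (by simp [Sym2.eq_swap]) hab
    have := h6 _ d' hd' (by rw [he']; simp [Sym2.eq_swap])
    rw [hl'] at this
    simp only [Walk.length_cons] at this
    have : Even q.length := by grind
    grind

/-- Closing a triangle over two edges that lie on no odd cycle puts them on one. -/
theorem evenPart_sup_edge_le_deleteEdges {a b c : V} (hab : G.Adj a b) (hbc : G.Adj b c)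
    (hac : a ≠ c) :
    (G ⊔ edge a c).evenPart ≤ G.evenPart.deleteEdges {s(a, b), s(b, c)} := by
  have hca : (G ⊔ edge a c).Adj c a := Or.inr (by simp [edge_adj, hac.symm])
  obtain ⟨h1, h2, h3⟩ := onOddCycle_of_triangle (G := G ⊔ edge a c) (Or.inl hab) (Or.inl hbc) hca
  intro x y hxy
  have hne : s(x, y) ≠ s(a, b) ∧ s(x, y) ≠ s(b, c) ∧ s(x, y) ≠ s(c, a) := by
    refine ⟨?_, ?_, ?_⟩ <;> intro h <;> have := hxy.2 <;> rw [h] at this <;> contradiction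
  rw [deleteEdges_adj]
  refine ⟨evenPart_anti_of_le le_sup_left hxy ?_, by simp [hne.1, hne.2.1]⟩
  rcases hxy.1 with h | h
  · exact h
  · rw [edge_adj] at h
    exact absurd (Sym2.eq_iff.2 h.1) (by rw [Sym2.eq_swap (a := a)]; exact hne.2.2 )

/-! ### Mini's answer to a move. -/

/-- A trail cannot pass between `uv` and the other edges, so it uses `uv` only or stays in `B`. -/
theorem trailsLEThree_of_isolated_edge {u v : V} {B : SimpleGraph V} (hB : TrailsLEThree B)
    (hG : G ≤ B ⊔ edge u v) (hu : ∀ w, G.Adj u w → w = v) (hv : ∀ w, G.Adj v w → w = u) :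
    TrailsLEThree G := by
  intro x y p hp
  have key : ∀ {x y : V} (p : G.Walk x y),
      (x = u ∨ x = v → ∀ e ∈ p.edges, e = s(u, v)) ∧ (¬ (x = u ∨ x = v) → s(u, v) ∉ p.edges) := by
    intro x y p
    induction p with
    | nil => simp
    | @cons x z y h p ih =>
      refine ⟨?_, ?_⟩
      · rintro (rfl | rfl)
        · have hz := hu z h
          subst hz
          intro e he
          rw [Walk.edges_cons, List.mem_cons] at he
          exact he.elim id (ih.1 (Or.inr rfl) e)
        · have hz := hv z h
          subst hz
          intro e he
          rw [Walk.edges_cons, List.mem_cons] at he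
          exact he.elim (fun h => h.trans Sym2.eq_swap) (ih.1 (Or.inl rfl) e)
      · intro hx
        have hz : ¬ (z = u ∨ z = v) := by
          rintro (rfl | rfl)
          · exact hx (Or.inr (hu x h.symm))
          · exact hx (Or.inl (hv x h.symm))
        rw [Walk.edges_cons, List.mem_cons, not_or]
        refine ⟨?_, ih.2 hz⟩
        rw [Sym2.eq_iff]
        rintro (⟨h1, -⟩ | ⟨-, h1⟩)
        · exact hx (Or.inl h1.symm)
        · exact hx (Or.inr h1.symm)
  by_cases hx : x = u ∨ x = v
  · have h1 := (key p).1 hx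
    have h2 := List.eq_replicate_of_mem h1
    have h3 := hp.edges_nodup
    rw [h2, List.nodup_replicate, Walk.length_edges] at h3
    omega
  · have h1 := (key p).2 hx
    have ht : ∀ e ∈ p.edges, e ∈ B.edgeSet := by
      intro e he
      have h2 := p.edges_subset_edgeSet he
      induction e with | _ a b =>
      rcases hG h2 with h2 | h2
      · exact h2
      · rw [edge_adj] at h2
        exact absurd (Sym2.eq_iff.2 h2.1) (fun h => h1 (h ▸ he))
    have := hB _ _ (p.transfer B ht) (hp.transfer ht)
    simpa using this

/-- Of two consecutive edges of a trail one must be `ac`. Four edges make two disjoint such pairs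
and would repeat `ac`. -/
theorem IsMatchingGraph.trailsLEThree {a c : V} {B : SimpleGraph V} (hB : IsMatchingGraph B)
    (hG : G ≤ B ⊔ edge a c) : TrailsLEThree G := by
  intro x y p hp
  have hstep : ∀ {x y z : V}, G.Adj x y → G.Adj y z → s(x, y) ≠ s(y, z) →
      s(x, y) = s(a, c) ∨ s(y, z) = s(a, c) := by
    intro x y z h1 h2 hne
    have h1' := hG h1
    have h2' := hG h2
    simp only [sup_adj, edge_adj] at h1' h2'
    rcases h1' with h1' | h1'
    · rcases h2' with h2' | h2'
      · exact absurd (by rw [hB _ _ _ h1' h2', Sym2.eq_swap]) hne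
      · exact Or.inr (Sym2.eq_iff.2 h2'.1)
    · exact Or.inl (Sym2.eq_iff.2 h1'.1)
  by_contra! hlen
  match p, hp, hlen with
  | .cons h1 (.cons h2 (.cons h3 (.cons h4 q))), hp, _ =>
    have hnd := hp.edges_nodup
    simp only [Walk.edges_cons, List.nodup_cons, List.mem_cons, not_or] at hnd
    obtain ⟨⟨h12, h13, h14, -⟩, ⟨h23, h24, -⟩, ⟨h34, -⟩, -⟩ := hnd
    rcases hstep h1 h2 h12 with e1 | e1 <;> rcases hstep h3 h4 h34 with e2 | e2
    · exact h13 (e1.trans e2.symm)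
    · exact h14 (e1.trans e2.symm)
    · exact h23 (e1.trans e2.symm)
    · exact h24 (e1.trans e2.symm)

theorem exists_sup_edge_of_evenPart_adj {m : ℕ} (hm : 4 ≤ m) (hG : OddCyclesLT G m) {a b c : V}
    (hab : G.evenPart.Adj a b) (hbc : G.evenPart.Adj b c) (hac : a ≠ c)
    (h6 : ∀ (r : V) (d : G.evenPart.Walk r r), d.IsCycle → s(a, b) ∈ d.edges → d.length < 6)
    (hc : ∀ (r : V) (d : G.evenPart.Walk r r), d.IsCycle → s(a, b) ∈ d.edges → c ∈ d.support)
    (ha : ∀ (r : V) (d : G.evenPart.Walk r r), d.IsCycle → s(b, c) ∈ d.edges → a ∈ d.support)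
    (hB : TrailsLEThree (G.evenPart.deleteEdges {s(a, b), s(b, c)})) :
    ∃ a c, a ≠ c ∧ ¬ G.Adj a c ∧ OddCyclesLT (G ⊔ edge a c) m ∧
      TrailsLEThree (G ⊔ edge a c).evenPart :=
  ⟨a, c, hac, not_adj_of_evenPart hab hbc, hG.sup_edge hm hab hbc hac h6 hc ha,
    hB.anti (evenPart_sup_edge_le_deleteEdges hab.1 hbc.1 hac)⟩

/-- If long trails of edges on no odd cycle appear after the insertion of `uv`, they can be
destroyed by closing a triangle over `uv`. -/
theorem exists_path_of_not_trailsLEThree {B : SimpleGraph V} (hB : TrailsLEThree B) {u v : V}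
    (hG : G.evenPart ≤ B ⊔ edge u v) (hT : ¬ TrailsLEThree G.evenPart) :
    ∃ a b c, G.evenPart.Adj a b ∧ G.evenPart.Adj b c ∧ a ≠ c ∧
      (s(a, b) = s(u, v) ∨ s(b, c) = s(u, v)) ∧
      (∀ (r : V) (d : G.evenPart.Walk r r), d.IsCycle → s(a, b) ∈ d.edges → d.length < 6) ∧
      (∀ (r : V) (d : G.evenPart.Walk r r), d.IsCycle → s(a, b) ∈ d.edges → c ∈ d.support) ∧
      (∀ (r : V) (d : G.evenPart.Walk r r), d.IsCycle → s(b, c) ∈ d.edges → a ∈ d.support) := by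
  have huv : G.evenPart.Adj u v := by
    by_contra hn
    refine hT (hB.anti fun x y hxy => (hG hxy).resolve_right fun h => hn ?_)
    rw [edge_adj] at h
    rcases h.1 with ⟨rfl, rfl⟩ | ⟨rfl, rfl⟩
    · exact hxy
    · exact hxy.symm
  by_cases hac : G.evenPart.IsAcyclic
  -- Without cycles, any even edge adjacent to `uv` serves; were there none, `uv` would be isolated
  -- and trails would still be short.
  · have hex : (∃ w, G.evenPart.Adj u w ∧ w ≠ v) ∨ ∃ w, G.evenPart.Adj v w ∧ w ≠ u := by
      by_contra! h
      exact hT (trailsLEThree_of_isolated_edge hB hG h.1 h.2)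
    rcases hex with ⟨w, hw, hne⟩ | ⟨w, hw, hne⟩
    · exact ⟨w, u, v, hw.symm, huv, hne, Or.inr rfl, fun r d hd => absurd hd (hac d),
        fun r d hd => absurd hd (hac d), fun r d hd => absurd hd (hac d)⟩
    · exact ⟨w, v, u, hw.symm, huv.symm, hne, Or.inr Sym2.eq_swap, fun r d hd => absurd hd (hac d),
        fun r d hd => absurd hd (hac d), fun r d hd => absurd hd (hac d)⟩
  -- `B'` has short trails, so every cycle of the even part uses `uv`, and `B'` is a forest with a
  -- unique path from `v` to `u`, of length at most 3. Every cycle is this path closed by `uv`: it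
  -- has at most 4 edges and contains the penultimate vertex of the path, which is taken as `a`.
  set B' := G.evenPart.deleteEdges {s(u, v)} with hB'def
  have hmemB' : ∀ e ∈ G.evenPart.edgeSet, e ≠ s(u, v) → e ∈ B'.edgeSet := by
    intro e he hne
    rw [hB'def, edgeSet_deleteEdges]
    exact ⟨he, hne⟩
  have hB' : TrailsLEThree B' := by
    refine hB.anti fun x y hxy => ?_
    rw [deleteEdges_adj] at hxy
    refine (hG hxy.1).resolve_right fun h => hxy.2 ?_
    rw [edge_adj] at h
    exact Sym2.eq_iff.2 h.1
  have hthrough : ∀ (r : V) (d : G.evenPart.Walk r r), d.IsCycle → s(u, v) ∈ d.edges := by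
    intro r d hd
    by_contra hn
    have ht : ∀ e ∈ d.edges, e ∈ B'.edgeSet := fun e he =>
      hmemB' e (d.edges_subset_edgeSet he) fun h => hn (h ▸ he)
    have h1 := hB' _ _ _ (hd.isTrail.transfer ht)
    have h2 := hd.four_le_length_of_evenPart
    rw [Walk.length_transfer] at h1
    omega
  have hB'ac : B'.IsAcyclic := by
    intro r d hd
    have h1 := hthrough r _ (hd.mapLe (G.evenPart.deleteEdges_le {s(u, v)}))
    have h2 := d.edges_subset_edgeSet (by simpa using h1)
    rw [hB'def, edgeSet_deleteEdges] at h2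
    exact h2.2 rfl
  have hpath : ∀ (r : V) (d : G.evenPart.Walk r r), d.IsCycle →
      ∃ q : B'.Walk v u, q.IsPath ∧ q.length + 1 = d.length ∧ ∀ e ∈ q.edges, e ∈ d.edges := by
    intro r d hd
    obtain ⟨q, hq, hqe, hql, hqd⟩ := hd.exists_isPath_of_mem_edges (hthrough r d hd)
    have ht : ∀ e ∈ q.edges, e ∈ B'.edgeSet := fun e he =>
      hmemB' e (q.edges_subset_edgeSet he) fun h => hqe (h ▸ he)
    exact ⟨q.transfer B' ht, hq.transfer ht, by simpa using hql,
      fun e he => (hqd e).2 (Or.inr (by simpa using he))⟩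
  obtain ⟨r, d, hd⟩ : ∃ (r : V) (d : G.evenPart.Walk r r), d.IsCycle := by
    unfold IsAcyclic at hac
    push Not at hac
    exact hac
  obtain ⟨q, hq, hql, -⟩ := hpath r d hd
  have hd4 := hd.four_le_length_of_evenPart
  have hqn : ¬ q.Nil := by
    rw [Walk.not_nil_iff_lt_length]
    omega
  have hadj := q.adj_penultimate hqn
  have hwe : s(q.penultimate, u) ∈ q.edges := q.mk_penultimate_end_mem_edges hqn
  have hadj' := deleteEdges_adj.1 hadj
  refine ⟨q.penultimate, u, v, hadj'.1, huv, ?_, Or.inr rfl, ?_, ?_, ?_⟩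
  · intro h
    exact hadj'.2 (by rw [h, Sym2.eq_swap]; rfl)
  · intro r d hd _
    obtain ⟨q', hq', hql', -⟩ := hpath r d hd
    have := hB' _ _ _ hq'.isTrail
    omega
  · intro r d hd _
    exact d.snd_mem_support_of_mem_edges (hthrough r d hd)
  · intro r d hd _
    obtain ⟨q', hq', -, hqd'⟩ := hpath r d hd
    have heq : q' = q := congrArg Subtype.val
      ((hB'ac.subsingleton_path v u).elim ⟨q', hq'⟩ ⟨q, hq⟩)
    exact d.fst_mem_support_of_mem_edges (hqd' _ (by rw [heq]; exact hwe))

/-- Mini's answer to the insertion of `uv`: some edge can be added such that all trails of edges on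
no odd cycle are short, unless no edge can be added at all. -/
theorem exists_answer {m : ℕ} (hm : 4 ≤ m) (hG : OddCyclesLT G m) {B : SimpleGraph V}
    (hB : TrailsLEThree B) {u v : V} (hGB : G.evenPart ≤ B ⊔ edge u v) :
    (∃ a c, a ≠ c ∧ ¬ G.Adj a c ∧ OddCyclesLT (G ⊔ edge a c) m ∧
      TrailsLEThree (G ⊔ edge a c).evenPart) ∨
    (TrailsLEThree G.evenPart ∧
      ∀ a c, a ≠ c → ¬ G.Adj a c → ¬ OddCyclesLT (G ⊔ edge a c) m) := by
  by_cases hT : TrailsLEThree G.evenPart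
  · by_cases hM : IsMatchingGraph G.evenPart
    · by_cases hex : ∃ a c, a ≠ c ∧ ¬ G.Adj a c ∧ OddCyclesLT (G ⊔ edge a c) m
      · obtain ⟨a, c, hac, hn, ho⟩ := hex
        exact Or.inl ⟨a, c, hac, hn, ho, hM.trailsLEThree (evenPart_sup_edge_le a c)⟩
      · push Not at hex
        exact Or.inr ⟨hT, hex⟩
    · unfold IsMatchingGraph at hM
      push Not at hM
      obtain ⟨a, b, c, hab, hbc, hac⟩ := hM
      have hA := hT.isAcyclic_evenPart
      exact Or.inl (exists_sup_edge_of_evenPart_adj hm hG hab hbc hac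
        (fun r d hd => absurd hd (hA d)) (fun r d hd => absurd hd (hA d))
        (fun r d hd => absurd hd (hA d)) (hT.anti (deleteEdges_le _)))
  · obtain ⟨a, b, c, hab, hbc, hac, he, h6, hc, ha⟩ := exists_path_of_not_trailsLEThree hB hGB hT
    -- One of the two deleted edges is `uv`, so what remains lies in `B`.
    refine Or.inl (exists_sup_edge_of_evenPart_adj hm hG hab hbc hac h6 hc ha (hB.anti ?_))
    intro x y hxy
    rw [deleteEdges_adj] at hxy
    refine (hGB hxy.1).resolve_right fun h => hxy.2 ?_
    rw [edge_adj] at h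
    rw [Sym2.eq_iff.2 h.1]
    exact he.imp Eq.symm Eq.symm

/-! ### Counting edges by degeneracy. -/

/-- The number of edges is at most `d (|V| - 1)` if every nonempty set of vertices contains a vertex
with at most `d` neighbours in the set. -/
theorem ncard_edgeSet_le_of_degenerate [Finite V] (d : ℕ)
    (h : ∀ S : Set V, S.Nonempty → ∃ v ∈ S, {w ∈ S | G.Adj v w}.ncard ≤ d) :
    G.edgeSet.ncard ≤ d * (Nat.card V - 1) := by
  have key : ∀ (n : ℕ) (S : Set V), S.ncard = n →
      {e ∈ G.edgeSet | ∀ x ∈ e, x ∈ S}.ncard ≤ d * (n - 1) := by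
    intro n
    induction n with
    | zero =>
      intro S hS
      rw [Set.ncard_eq_zero] at hS
      have : {e ∈ G.edgeSet | ∀ x ∈ e, x ∈ S} = ∅ := by
        ext e
        induction e with | _ a b =>
        simp only [hS, Set.mem_ofPred_eq, Set.mem_empty_iff_false, iff_false]
        exact fun h => h.2 a (by simp)
      rw [this]
      simp
    | succ n ih =>
      intro S hS
      obtain ⟨v, hv, hd⟩ := h S (Set.nonempty_of_ncard_ne_zero (by omega))
      have h1 := ih (S \ {v}) (by rw [Set.ncard_sdiff_singleton_of_mem hv]; omega)
      -- The last remaining vertex contributes no edge instead of `d`, whence the factor `|V| - 1`.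
      rcases Nat.eq_zero_or_pos n with rfl | hn
      · rw [Set.ncard_eq_one] at hS
        obtain ⟨w, rfl⟩ := hS
        have : {e ∈ G.edgeSet | ∀ x ∈ e, x ∈ ({w} : Set V)} = ∅ := by
          ext e
          induction e with | _ a b =>
          simp only [Set.mem_ofPred_eq, Set.mem_empty_iff_false, iff_false]
          rintro ⟨h1, h2⟩
          have e1 := h2 a (by simp)
          have e2 := h2 b (by simp)
          simp only [Set.mem_singleton_iff] at e1 e2
          exact (G.ne_of_adj h1) (e1.trans e2.symm)
        rw [this]
        simp
      have hsub : {e ∈ G.edgeSet | ∀ x ∈ e, x ∈ S} ⊆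
          {e ∈ G.edgeSet | ∀ x ∈ e, x ∈ S \ {v}} ∪
            (fun w => s(v, w)) '' {w ∈ S | G.Adj v w} := by
        rintro e ⟨he, heS⟩
        by_cases hve : v ∈ e
        · right
          obtain ⟨w, rfl⟩ := hve
          exact ⟨w, ⟨heS w (by simp), he⟩, rfl⟩
        · left
          refine ⟨he, fun x hx => ⟨heS x hx, ?_⟩⟩
          rintro rfl
          exact hve hx
      calc _ ≤ _ := Set.ncard_le_ncard hsub (Set.toFinite _)
        _ ≤ _ := Set.ncard_union_le _ _
        _ ≤ d * (n - 1) + d := add_le_add h1 ((Set.ncard_image_le (Set.toFinite _)).trans hd)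
        _ = d * (n + 1 - 1) := by
          obtain ⟨k, rfl⟩ : ∃ k, n = k + 1 := ⟨n - 1, by omega⟩
          simp
          ring
  have := key _ Set.univ rfl
  simpa [Set.ncard_univ] using this

/-- Every nonempty vertex set contains the start of a path that passes through all neighbours of its
start in the set. -/
theorem exists_isPath_neighbors_subset [Finite V] {S : Set V} (hS : S.Nonempty) :
    ∃ u ∈ S, ∃ (v : V) (p : G.Walk u v), p.IsPath ∧ ∀ w ∈ S, G.Adj u w → w ∈ p.support := by
  classical
  have := Fintype.ofFinite V
  -- Only the start has to lie in `S`: a longest such path cannot be extended at the front by a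
  -- neighbour in `S`.
  let P : ℕ → Prop := fun n => ∃ u ∈ S, ∃ (v : V) (p : G.Walk u v), p.IsPath ∧ p.length = n
  obtain ⟨x, hx⟩ := hS
  have h0 : P 0 := ⟨x, hx, x, Walk.nil, by simp, rfl⟩
  obtain ⟨u, hu, v, p, hp, hpl⟩ := Nat.findGreatest_spec (Nat.zero_le (Fintype.card V)) h0
  refine ⟨u, hu, v, p, hp, fun w hw hadj => ?_⟩
  by_contra hn
  have hp' : (Walk.cons hadj.symm p).IsPath := (Walk.cons_isPath_iff _ _).2 ⟨hp, hn⟩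
  have := Nat.le_findGreatest (P := P) hp'.length_lt.le ⟨w, hw, v, _, hp', rfl⟩
  rw [Walk.length_cons] at this
  omega

/-- A graph of minimum degree at least `3k - 1` on a vertex set contains an odd cycle of length at
least `2k + 1` or an even cycle of length at least `4k`. -/
theorem exists_long_cycle [Finite V] {k : ℕ} (hk : 1 ≤ k) {S : Set V} (hS : S.Nonempty)
    (hdeg : ∀ v ∈ S, 3 * k - 1 ≤ {w ∈ S | G.Adj v w}.ncard) :
    ∃ (r : V) (c : G.Walk r r), c.IsCycle ∧
      (Odd c.length ∧ 2 * k + 1 ≤ c.length ∨ Even c.length ∧ 4 * k ≤ c.length) := by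
  classical
  obtain ⟨u, hu, v, p, hp, hnb⟩ := exists_isPath_neighbors_subset (G := G) hS
  have hcyc : ∀ i, 2 ≤ i → i ≤ p.length → G.Adj u (p.getVert i) →
      ∃ (r : V) (c : G.Walk r r), c.IsCycle ∧ c.length = i + 1 := by
    intro i hi hil hadj
    have hpi : (p.take i).IsPath := hp.take i
    have hlen : (p.take i).length = i := by simp [hil]
    refine ⟨_, Walk.cons hadj.symm (p.take i), (Walk.cons_isCycle_iff _ _).2 ⟨hpi, fun h => ?_⟩, ?_⟩
    · have := hpi.length_eq_one_of_mem_edges (by rwa [Sym2.eq_swap])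
      omega
    · rw [Walk.length_cons, hlen]
  by_contra! hno
  let I : Finset ℕ := (Finset.range (p.length + 1)).filter fun i => G.Adj u (p.getVert i)
  have hIcard : 3 * k - 1 ≤ I.card := by
    refine (hdeg u hu).trans ?_
    have hsub : {w ∈ S | G.Adj u w} ⊆ ↑(I.image p.getVert) := by
      rintro w ⟨hw, hadj⟩
      obtain ⟨i, rfl, hi⟩ := Walk.mem_support_iff_exists_getVert.1 (hnb w hw hadj)
      simp only [Finset.coe_image, Set.mem_image]
      exact ⟨i, by simp [I, hadj]; omega, rfl⟩
    calc _ ≤ _ := Set.ncard_le_ncard hsub (Finset.finite_toSet _)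
      _ = _ := Set.ncard_coe_finset _
      _ ≤ _ := Finset.card_image_le
  -- A neighbour at position `i ≥ 2` closes a cycle of length `i + 1`. So even positions are at most
  -- `2k - 2` and odd ones at most `4k - 3`, which leaves `(k - 1) + (2k - 1) = 3k - 2`, one too
  -- few.
  have hI : I ⊆ (Finset.range k).image (fun j => 2 * j + 2) \ {2 * k} ∪
      (Finset.range (2 * k - 1)).image (fun j => 2 * j + 1) := by
    intro i hi
    simp only [I, Finset.mem_filter, Finset.mem_range] at hi
    have hi0 : i ≠ 0 := by
      rintro rfl
      simp at hi
    simp only [Finset.mem_union, Finset.mem_sdiff, Finset.mem_image, Finset.mem_range,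
      Finset.mem_singleton]
    rcases Nat.even_or_odd' i with ⟨j, hj | hj⟩
    · left
      obtain ⟨r, c, hc, hcl⟩ := hcyc i (by omega) (by omega) hi.2
      have := (hno r c hc).1 ⟨j, by omega⟩
      exact ⟨⟨j - 1, by omega, by omega⟩, by omega⟩
    · right
      refine ⟨j, ?_, hj.symm⟩
      by_cases hj0 : j = 0
      · omega
      obtain ⟨r, c, hc, hcl⟩ := hcyc i (by omega) (by omega) hi.2
      have := (hno r c hc).2 ⟨j + 1, by omega⟩
      omega
  have h1 := Finset.card_le_card hI
  have h2 : ((Finset.range k).image (fun j => 2 * j + 2) \ {2 * k}).card ≤ k - 1 := by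
    rw [Finset.card_sdiff_of_subset]
    · have := Finset.card_image_le (s := Finset.range k) (f := fun j => 2 * j + 2)
      simp only [Finset.card_range] at this
      rw [Finset.card_singleton]
      omega
    · simp only [Finset.singleton_subset_iff, Finset.mem_image, Finset.mem_range]
      exact ⟨k - 1, by omega, by omega⟩
  have h3 := Finset.card_image_le (s := Finset.range (2 * k - 1)) (f := fun j => 2 * j + 1)
  have h4 := Finset.card_union_le ((Finset.range k).image (fun j => 2 * j + 2) \ {2 * k})
    ((Finset.range (2 * k - 1)).image (fun j => 2 * j + 1))
  simp only [Finset.card_range] at h3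
  omega

theorem OddCyclesLT.ncard_edgeSet_le [Finite V] {k : ℕ} (hk : 2 ≤ k)
    (hG : OddCyclesLT G (2 * k + 1)) (hT : TrailsLEThree G.evenPart) :
    G.edgeSet.ncard ≤ (3 * k - 2) * (Nat.card V - 1) := by
  apply ncard_edgeSet_le_of_degenerate
  intro S hS
  by_contra! hdeg
  obtain ⟨r, c, hc, ⟨ho, hl⟩ | ⟨he, hl⟩⟩ := exists_long_cycle (G := G) (k := k) (by omega) hS
    fun v hv => by have := hdeg v hv; omega
  · have := hG r c hc ho
    omega
  · by_cases hodd : ∃ f ∈ c.edges, OnOddCycle G f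
    · obtain ⟨f, hf, hfo⟩ := hodd
      -- From `4k ≤ c.length < 2 * d.length` the odd cycle `d` is longer than `2k`.
      obtain ⟨z, d, hd, hdo, hdl⟩ := (hc.onOddCycle_of_even he hf hfo).2
      have := hG z d hd hdo
      omega
    · push Not at hodd
      have ht : ∀ e ∈ c.edges, e ∈ G.evenPart.edgeSet := fun e he =>
        mem_edgeSet_evenPart.2 ⟨c.edges_subset_edgeSet he, hodd e he⟩
      have := hT _ _ _ (hc.isTrail.transfer ht)
      rw [Walk.length_transfer] at this
      omega

end SimpleGraph

/-! ### From graphs to the game. -/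

open SimpleGraph

theorem familyFree_oddCyclesGE_iff {V : Type*} {G : SimpleGraph V} {m : ℕ} :
    FamilyFree (oddCyclesGE m) G ↔ OddCyclesLT G m := by
  constructor
  · intro h u c hc ho
    by_contra! hlen
    exact h ⟨c.length, cycleGraph c.length⟩ ⟨c.length, hc.three_le_length, hlen, ho, rfl⟩
      ((cycleGraph_isContained_iff hc.three_le_length).2 ⟨u, c, hc, rfl⟩)
  · rintro h F ⟨l, h3, hm, ho, rfl⟩ hF
    obtain ⟨u, c, hc, rfl⟩ := (cycleGraph_isContained_iff h3).1 hF
    have := h u c hc ho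
    omega

theorem legalMove_oddCyclesGE_iff {V : Type*} {G H : SimpleGraph V} {m : ℕ} :
    LegalMove (oddCyclesGE m) G H ↔
      ∃ u v, u ≠ v ∧ ¬ G.Adj u v ∧ H = G ⊔ edge u v ∧ OddCyclesLT H m := by
  simp only [LegalMove, familyFree_oddCyclesGE_iff]

theorem gameScore_max_le {V : Type*} [Finite V] {𝓕 : GraphFamily} {G : SimpleGraph V} {N : ℕ}
    (hend : (∀ H, ¬ LegalMove 𝓕 G H) → G.edgeSet.ncard ≤ N)
    (hmove : ∀ H, LegalMove 𝓕 G H → gameScore 𝓕 Player.mini H ≤ N) :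
    gameScore 𝓕 Player.max G ≤ N := by
  rw [gameScore]
  split_ifs with h
  · obtain ⟨H, hH⟩ := h
    have : Nonempty {H : SimpleGraph V // LegalMove 𝓕 G H} := ⟨⟨H, hH⟩⟩
    exact ciSup_le fun H => hmove H.1 H.2
  · exact hend (not_exists.1 h)

theorem gameScore_mini_le {V : Type*} [Finite V] {𝓕 : GraphFamily} {G : SimpleGraph V} {N : ℕ}
    (h : (∃ H, LegalMove 𝓕 G H ∧ gameScore 𝓕 Player.max H ≤ N) ∨
      ((∀ H, ¬ LegalMove 𝓕 G H) ∧ G.edgeSet.ncard ≤ N)) :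
    gameScore 𝓕 Player.mini G ≤ N := by
  rw [gameScore]
  rcases h with ⟨H, hH, hle⟩ | ⟨hno, hle⟩
  · rw [if_pos ⟨H, hH⟩]
    exact (ciInf_le (OrderBot.bddBelow _) (⟨H, hH⟩ : {H : SimpleGraph V // LegalMove 𝓕 G H})).trans
      hle
  · rwa [if_neg (not_exists.2 hno)]

/-- Induction on the number of missing edges; one round is a move of Max and the answer from
`exists_answer`, which restores the condition on trails. -/
theorem gameScore_max_le_of_trailsLEThree {V : Type*} [Finite V] {k : ℕ} (hk : 2 ≤ k)
    (G : SimpleGraph V) (hG : OddCyclesLT G (2 * k + 1)) (hT : TrailsLEThree G.evenPart) :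
    gameScore (oddCyclesGE (2 * k + 1)) Player.max G ≤ (3 * k - 2) * (Nat.card V - 1) := by
  induction hn : (Gᶜ).edgeSet.ncard using Nat.strong_induction_on generalizing G with
  | _ n ih =>
  refine gameScore_max_le (fun _ => hG.ncard_edgeSet_le hk hT) fun H hH => ?_
  have hlt := hH.ncard_compl_lt
  obtain ⟨u, v, -, -, rfl, hHo⟩ := legalMove_oddCyclesGE_iff.1 hH
  apply gameScore_mini_le
  rcases exists_answer (by omega) hHo hT (evenPart_sup_edge_le u v) with
    ⟨a, c, hac, hn', ho, hT'⟩ | ⟨hT', hno⟩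
  · have hmove : LegalMove (oddCyclesGE (2 * k + 1)) (G ⊔ edge u v) (G ⊔ edge u v ⊔ edge a c) :=
      legalMove_oddCyclesGE_iff.2 ⟨a, c, hac, hn', rfl, ho⟩
    exact Or.inl ⟨_, hmove, ih _ (by have := hmove.ncard_compl_lt; omega) _ ho hT' rfl⟩
  · refine Or.inr ⟨fun H' hH' => ?_, hHo.ncard_edgeSet_le hk hT'⟩
    obtain ⟨a, c, hac, hn', rfl, ho⟩ := legalMove_oddCyclesGE_iff.1 hH'
    exact hno a c hac hn' ho

theorem corollary1p4 (k n : ℕ) (hk : 2 ≤ k) (hn : 1 ≤ n) :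
    (gameSaturationNumber n (oddCyclesGE (2 * k + 1)) : ℤ) ≤ (3 * (k : ℤ) + 1) * ((n : ℤ) - 1) := by
  have hG : OddCyclesLT (⊥ : SimpleGraph (Fin n)) (2 * k + 1) :=
    fun u c hc => absurd hc (isAcyclic_bot c)
  have hT : TrailsLEThree (⊥ : SimpleGraph (Fin n)).evenPart := by
    intro u v p _
    cases p with
    | nil => simp
    | cons h p => exact absurd h.1 (by simp)
  have h := gameScore_max_le_of_trailsLEThree hk _ hG hT
  rw [Nat.card_eq_fintype_card, Fintype.card_fin] at h
  have h2 : gameSaturationNumber n (oddCyclesGE (2 * k + 1)) ≤ (3 * k + 1) * (n - 1) :=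
    h.trans (Nat.mul_le_mul_right _ (by omega))
  have h3 : ((gameSaturationNumber n (oddCyclesGE (2 * k + 1)) : ℕ) : ℤ) ≤
      (((3 * k + 1) * (n - 1) : ℕ) : ℤ) := by exact_mod_cast h2
  rw [Nat.cast_mul, Nat.cast_sub hn] at h3
  push_cast at h3
  exact h3
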